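/- Let $E$ be a (real or complex) Banach space. A bounded linear operator $T:E\to E$ is weakly compact if it maps the closed unit ball $B_E$ to a relatively weakly compact set, and $W(E)$ denotes the Banach algebra of all weakly compact operators $E\to E$, with composition as product and the operator norm. $E$ has the weakly compact approximation property (W.A.P.) if there is a constant $C<\infty$ such that for every weakly compact set $D\subset E$ and every $\varepsilon>0$ there is $V\in W(E)$ with $$\sup_{x\in D}\|x-Vx\|<\varepsilon\quad\text{and}\quad \|V\|\le C.$$ A Banach algebra $A$ has a bounded left approximate identity if there is a bounded net $(x_\alpha)\subset A$ such that $\lim_\alpha\|y-x_\alpha y\|=0$ for every $y\in A$. The James space $J$ is the real Banach space of all real sequences $x=(x_j)_{j\ge 1}$ with $\lim_{j\to\infty}x_j=0$ and $$\|x\|^2=\sup\Big\{\sum_{j=1}^n|x_{p_{j+1}}-x_{p_j}|^2 : n\in\mathbb N,\ 1\le p_1<p_2<\dots<p_{n+1}\Big\}<\infty.$$ Proposition 2.5. (i) If $E$ has the W.A.P., then the Banach algebra $W(E)$ has a bounded left approximate identity. (ii) $W(J)$ has a bounded left approximate identity. -/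

import Mathlib

open Filter Topology Set

/-! ### Weakly compact sets and weakly compact operators -/

section WeakCompactness

variable {𝕜 : Type*} [RCLike 𝕜]
variable {E F G : Type*} [NormedAddCommGroup E] [NormedSpace 𝕜 E]
  [NormedAddCommGroup F] [NormedSpace 𝕜 F] [NormedAddCommGroup G] [NormedSpace 𝕜 G]

variable (𝕜) in
/-- `D` is compact in the weak topology of `E`. -/
def IsWeaklyCompactSet (D : Set E) : Prop :=
  IsCompact (toWeakSpace 𝕜 E '' D)

/-- A bounded operator is weakly compact if it maps the closed unit ball to a relatively weakly
compact set, that is, a set whose closure in the weak topology is weakly compact. -/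
def IsWeaklyCompactOperator (T : E →L[𝕜] F) : Prop :=
  IsCompact (closure (toWeakSpace 𝕜 F '' (T '' Metric.closedBall (0 : E) 1)))

theorem isWeaklyCompactOperator_iff {T : E →L[𝕜] F} :
    IsWeaklyCompactOperator T ↔ ∃ K : Set (WeakSpace 𝕜 F), IsCompact K ∧
      ∀ x : E, ‖x‖ ≤ 1 → toWeakSpace 𝕜 F (T x) ∈ K := by
  constructor
  · intro h
    refine ⟨_, h, fun x hx => subset_closure ?_⟩
    exact ⟨T x, ⟨x, by simpa using hx, rfl⟩, rfl⟩
  · rintro ⟨K, hK, h⟩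
    refine hK.closure_of_subset ?_
    rintro _ ⟨_, ⟨x, hx, rfl⟩, rfl⟩
    exact h x (by simpa using hx)

theorem isWeaklyCompactOperator_zero : IsWeaklyCompactOperator (0 : E →L[𝕜] F) :=
  isWeaklyCompactOperator_iff.2 ⟨{0}, isCompact_singleton, fun x _ => by simp⟩

theorem IsWeaklyCompactOperator.add {S T : E →L[𝕜] F} (hS : IsWeaklyCompactOperator S)
    (hT : IsWeaklyCompactOperator T) : IsWeaklyCompactOperator (S + T) := by
  obtain ⟨K, hK, hSK⟩ := isWeaklyCompactOperator_iff.1 hS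
  obtain ⟨L, hL, hTL⟩ := isWeaklyCompactOperator_iff.1 hT
  refine isWeaklyCompactOperator_iff.2
    ⟨_, (hK.prod hL).image (continuous_fst.add continuous_snd), fun x hx => ?_⟩
  exact ⟨(_, _), ⟨hSK x hx, hTL x hx⟩, by simp⟩

/-- Composing a weakly compact operator with a bounded operator on the left. -/
theorem IsWeaklyCompactOperator.clm_comp {T : E →L[𝕜] F} (hT : IsWeaklyCompactOperator T)
    (S : F →L[𝕜] G) : IsWeaklyCompactOperator (S.comp T) := by
  obtain ⟨K, hK, h⟩ := isWeaklyCompactOperator_iff.1 hT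
  exact isWeaklyCompactOperator_iff.2
    ⟨_, hK.image (WeakSpace.map S).continuous, fun x hx => ⟨_, h x hx, rfl⟩⟩

theorem IsWeaklyCompactOperator.smul {T : E →L[𝕜] F} (hT : IsWeaklyCompactOperator T) (c : 𝕜) :
    IsWeaklyCompactOperator (c • T) := by
  have h := hT.clm_comp (c • ContinuousLinearMap.id 𝕜 F)
  have e : (c • ContinuousLinearMap.id 𝕜 F).comp T = c • T := by ext x; simp
  rwa [e] at h

/-- The weakly compact operators into a Banach space are closed in the operator norm. -/
theorem isClosed_setOf_isWeaklyCompactOperator [CompleteSpace F] :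
    IsClosed {T : E →L[𝕜] F | IsWeaklyCompactOperator T} := by
  refine isClosed_of_closure_subset fun T hT => ?_
  have happ : ∀ n : ℕ, ∃ S : E →L[𝕜] F, IsWeaklyCompactOperator S ∧
      ‖T - S‖ < 1 / ((n : ℝ) + 1) := fun n => by
    obtain ⟨S, hS, hd⟩ := Metric.mem_closure_iff.1 hT _ (Nat.one_div_pos_of_nat (α := ℝ) (n := n))
    exact ⟨S, hS, by rwa [dist_eq_norm] at hd⟩
  choose S hS hTS using happ
  -- every ultrafilter on the unit ball has a weak limit under `T`
  have hlim : ∀ U : Ultrafilter E, (∀ᶠ x in (U : Filter E), ‖x‖ ≤ 1) →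
      ∃ y : F, ∀ f : StrongDual 𝕜 F, Tendsto (fun x => f (T x)) U (𝓝 (f y)) := by
    intro U hU
    have hy : ∀ n, ∃ y : F, ∀ f : StrongDual 𝕜 F,
        Tendsto (fun x => f (S n x)) U (𝓝 (f y)) := by
      intro n
      obtain ⟨K, hK, h⟩ := isWeaklyCompactOperator_iff.1 (hS n)
      obtain ⟨y, -, hy⟩ := isCompact_iff_ultrafilter_le_nhds'.1 hK
        (U.map fun x => toWeakSpace 𝕜 F (S n x)) (hU.mono h)
      refine ⟨(toWeakSpace 𝕜 F).symm y, fun f => ?_⟩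
      have hc : Continuous fun z : WeakSpace 𝕜 F => f ((toWeakSpace 𝕜 F).symm z) :=
        WeakBilin.eval_continuous (topDualPairing 𝕜 F).flip f
      exact (hc.tendsto y).comp hy
    choose y hy using hy
    have hdist : ∀ n m, ‖y n - y m‖ ≤ ‖S n - S m‖ := fun n m => by
      refine NormedSpace.norm_le_dual_bound 𝕜 _ (norm_nonneg _) fun f => ?_
      have ht : Tendsto (fun x => ‖f (S n x) - f (S m x)‖) U (𝓝 ‖f (y n) - f (y m)‖) :=
        ((hy n f).sub (hy m f)).norm
      rw [map_sub]
      refine le_of_tendsto ht (hU.mono fun x hx => ?_)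
      rw [← map_sub, mul_comm]
      refine (f.le_opNorm _).trans (mul_le_mul_of_nonneg_left ?_ (norm_nonneg _))
      exact ((S n - S m).le_opNorm x).trans (mul_le_of_le_one_right (norm_nonneg _) hx)
    have hST : Tendsto S atTop (𝓝 T) := by
      refine tendsto_iff_norm_sub_tendsto_zero.2 (squeeze_zero (fun _ => norm_nonneg _)
        (fun n => ?_) tendsto_one_div_add_atTop_nhds_zero_nat)
      rw [norm_sub_rev]
      exact (hTS n).le
    have hcau : CauchySeq y := by
      refine Metric.cauchySeq_iff.2 fun ε hε => ?_
      obtain ⟨N, hN⟩ := Metric.cauchySeq_iff.1 hST.cauchySeq ε hε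
      refine ⟨N, fun m hm n hn => lt_of_le_of_lt ?_ (hN m hm n hn)⟩
      rw [dist_eq_norm, dist_eq_norm]
      exact hdist m n
    obtain ⟨z, hz⟩ := cauchySeq_tendsto_of_complete hcau
    refine ⟨z, fun f => ?_⟩
    have hunif : TendstoUniformlyOn (fun n x => f (S n x)) (fun x => f (T x)) atTop
        {x : E | ‖x‖ ≤ 1} := by
      rw [Metric.tendstoUniformlyOn_iff]
      intro ε hε
      have h0 : Tendsto (fun n => ‖f‖ * ‖S n - T‖) atTop (𝓝 0) := by
        simpa using (tendsto_iff_norm_sub_tendsto_zero.1 hST).const_mul ‖f‖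
      filter_upwards [h0.eventually_lt_const hε] with n hn x hx
      refine lt_of_le_of_lt ?_ hn
      rw [dist_comm, dist_eq_norm, ← map_sub]
      refine (f.le_opNorm _).trans (mul_le_mul_of_nonneg_left ?_ (norm_nonneg _))
      exact ((S n - T).le_opNorm x).trans (mul_le_of_le_one_right (norm_nonneg _) hx)
    have hfilt := (tendstoUniformlyOn_iff_tendstoUniformlyOnFilter.1 hunif).mono_right
      (Filter.le_principal_iff.2 hU)
    exact hfilt.tendsto_of_eventually_tendsto (Eventually.of_forall fun n => hy n f)
      ((f.continuous.tendsto z).comp hz)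
  -- the weak limits form a continuous image of the compact space of ultrafilters on the ball
  have hlim' : ∀ U : Ultrafilter {x : E // ‖x‖ ≤ 1}, ∃ y : F, ∀ f : StrongDual 𝕜 F,
      Tendsto (fun x : {x : E // ‖x‖ ≤ 1} => f (T x)) U (𝓝 (f y)) := fun U => by
    obtain ⟨y, hy⟩ := hlim (U.map Subtype.val) (eventually_map.2 (Eventually.of_forall fun x => x.2))
    exact ⟨y, fun f => (hy f).comp tendsto_map⟩
  choose g hg using hlim'
  have hcont : Continuous fun U => toWeakSpace 𝕜 F (g U) := by
    refine WeakBilin.continuous_of_continuous_eval (topDualPairing 𝕜 F).flip fun f => ?_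
    let _ : TopologicalSpace {x : E // ‖x‖ ≤ 1} := ⊥
    have hd := isDenseInducing_pure (α := {x : E // ‖x‖ ≤ 1})
    have ht : ∀ U : Ultrafilter {x : E // ‖x‖ ≤ 1},
        Tendsto (fun x : {x : E // ‖x‖ ≤ 1} => f (T x)) (comap pure (𝓝 U)) (𝓝 (f (g U))) :=
      fun U => (hg U f).mono_left (ultrafilter_comap_pure_nhds U)
    have hext := hd.continuous_extend fun U => ⟨_, ht U⟩
    have heq : hd.extend (fun x : {x : E // ‖x‖ ≤ 1} => f (T x)) = fun U => f (g U) :=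
      funext fun U => hd.extend_eq_of_tendsto (ht U)
    rw [heq] at hext
    exact hext
  refine isWeaklyCompactOperator_iff.2 ⟨_, isCompact_range hcont, fun x hx => ⟨pure ⟨x, hx⟩, ?_⟩⟩
  refine congrArg _ ((SeparatingDual.eq_iff_forall_dual_eq (R := 𝕜)).2 fun f => ?_)
  exact tendsto_nhds_unique (hg (pure ⟨x, hx⟩) f) (tendsto_pure_nhds _ _)

variable (𝕜 E) in
/-- `W(E)`, the algebra of weakly compact operators on `E`, with composition as product and with
the operator norm. -/
def WeaklyCompactOperators : NonUnitalSubalgebra 𝕜 (E →L[𝕜] E) where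
  carrier := {T | IsWeaklyCompactOperator T}
  add_mem' hS hT := hS.add hT
  zero_mem' := isWeaklyCompactOperator_zero
  mul_mem' := fun {S _} _ hT => hT.clm_comp S
  smul_mem' c _ hT := hT.smul c

instance [CompleteSpace E] : CompleteSpace (WeaklyCompactOperators 𝕜 E) :=
  (isClosed_setOf_isWeaklyCompactOperator (𝕜 := 𝕜) (E := E) (F := E)).completeSpace_coe

variable (𝕜 E) in
/-- The weakly compact approximation property (W.A.P.): for some constant `C`, the identity can be
approximated uniformly on each weakly compact set by weakly compact operators of norm at most `C`.
-/
def HasWAP : Prop :=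
  ∃ C : ℝ, ∀ D : Set E, IsWeaklyCompactSet 𝕜 D → ∀ ε : ℝ, 0 < ε →
    ∃ V : E →L[𝕜] E, IsWeaklyCompactOperator V ∧
      (⨆ x ∈ D, ENNReal.ofReal ‖x - V x‖) < ENNReal.ofReal ε ∧ ‖V‖ ≤ C

end WeakCompactness

/-- `A` has a bounded left approximate identity: a bounded net `(x α)`, indexed by a nonempty
directed set, with `‖y - x α * y‖ → 0` for each `y` in `A`. -/
def HasBLAI.{w} (A : Type w) [NonUnitalNormedRing A] : Prop :=
  ∃ (ι : Type w) (_ : Preorder ι) (_ : IsDirectedOrder ι) (_ : Nonempty ι) (x : ι → A),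
    (∃ K : ℝ, ∀ α, ‖x α‖ ≤ K) ∧ ∀ y : A, Tendsto (fun α => ‖y - x α * y‖) atTop (𝓝 0)

/-! ### The James space -/

/-- The values `∑_{i=1}^{n} |x_{p_{i+1}} - x_{p_i}|²` for indices `p_1 < p_2 < ⋯ < p_{n+1}`.
The case `n = 0` only adds the value `0` and does not change the supremum. -/
def squareVariations (x : ℕ → ℝ) : Set ℝ :=
  {s | ∃ (n : ℕ) (p : Fin (n + 1) → ℕ), StrictMono p ∧
    s = ∑ i : Fin n, |x (p i.succ) - x (p i.castSucc)| ^ 2}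

/-- The square variation norm; it is used only where the supremum is finite. -/
noncomputable def squareVariationNorm (x : ℕ → ℝ) : ℝ :=
  Real.sqrt (sSup (squareVariations x))

theorem squareVariations_zero_mem (x : ℕ → ℝ) : 0 ∈ squareVariations x :=
  ⟨0, fun _ => 0, fun a b hab => by omega, by simp⟩

theorem le_squareVariationNorm_sq {x : ℕ → ℝ} (hx : BddAbove (squareVariations x)) {s : ℝ}
    (hs : s ∈ squareVariations x) : s ≤ squareVariationNorm x ^ 2 := by
  rw [squareVariationNorm, Real.sq_sqrt]
  · exact le_csSup hx hs
  · exact le_csSup hx (squareVariations_zero_mem x)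

theorem squareVariationNorm_le {x : ℕ → ℝ} {C : ℝ} (hC : 0 ≤ C)
    (h : ∀ s ∈ squareVariations x, s ≤ C ^ 2) : squareVariationNorm x ≤ C :=
  Real.sqrt_le_iff.2 ⟨hC, csSup_le ⟨0, squareVariations_zero_mem x⟩ h⟩

theorem squareVariations_add_le {x y : ℕ → ℝ} (hx : BddAbove (squareVariations x))
    (hy : BddAbove (squareVariations y)) {s : ℝ} (hs : s ∈ squareVariations (x + y)) :
    s ≤ (squareVariationNorm x + squareVariationNorm y) ^ 2 := by
  obtain ⟨n, p, hp, rfl⟩ := hs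
  have hX := le_squareVariationNorm_sq hx ⟨n, p, hp, rfl⟩
  have hY := le_squareVariationNorm_sq hy ⟨n, p, hp, rfl⟩
  have hA : 0 ≤ squareVariationNorm x := Real.sqrt_nonneg _
  have hB : 0 ≤ squareVariationNorm y := Real.sqrt_nonneg _
  simp only [sq_abs] at hX hY ⊢
  have hcs := Finset.sum_mul_sq_le_sq_mul_sq Finset.univ
    (fun i : Fin n => x (p i.succ) - x (p i.castSucc))
    (fun i : Fin n => y (p i.succ) - y (p i.castSucc))
  have hcross : (∑ i : Fin n, (x (p i.succ) - x (p i.castSucc)) *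
      (y (p i.succ) - y (p i.castSucc))) ≤ squareVariationNorm x * squareVariationNorm y := by
    refine le_of_sq_le_sq ?_ (mul_nonneg hA hB)
    rw [mul_pow]
    exact hcs.trans (mul_le_mul hX hY (Finset.sum_nonneg fun _ _ => sq_nonneg _) (sq_nonneg _))
  have hexp : (∑ i : Fin n, ((x + y) (p i.succ) - (x + y) (p i.castSucc)) ^ 2) =
      (∑ i : Fin n, (x (p i.succ) - x (p i.castSucc)) ^ 2) +
      2 * (∑ i : Fin n, (x (p i.succ) - x (p i.castSucc)) * (y (p i.succ) - y (p i.castSucc))) +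
      ∑ i : Fin n, (y (p i.succ) - y (p i.castSucc)) ^ 2 := by
    rw [Finset.mul_sum, ← Finset.sum_add_distrib, ← Finset.sum_add_distrib]
    refine Finset.sum_congr rfl fun i _ => ?_
    simp only [Pi.add_apply]
    ring
  rw [hexp]
  nlinarith

theorem squareVariations_smul_le {x : ℕ → ℝ} (hx : BddAbove (squareVariations x)) (c : ℝ) {s : ℝ}
    (hs : s ∈ squareVariations (c • x)) : s ≤ (|c| * squareVariationNorm x) ^ 2 := by
  obtain ⟨n, p, hp, rfl⟩ := hs
  have hX := le_squareVariationNorm_sq hx ⟨n, p, hp, rfl⟩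
  rw [mul_pow]
  refine le_trans (le_of_eq ?_) (mul_le_mul_of_nonneg_left hX (sq_nonneg |c|))
  rw [Finset.mul_sum]
  refine Finset.sum_congr rfl fun i _ => ?_
  rw [Pi.smul_apply, Pi.smul_apply, smul_eq_mul, smul_eq_mul, ← mul_sub, abs_mul, mul_pow]

/-- The real sequences that tend to `0` and have finite square variation. -/
def jamesSubmodule : Submodule ℝ (ℕ → ℝ) where
  carrier := {x | Tendsto x atTop (𝓝 0) ∧ BddAbove (squareVariations x)}
  add_mem' {x y} hx hy := ⟨by simpa only [add_zero] using! hx.1.add hy.1,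
    ⟨_, fun _ hs => squareVariations_add_le hx.2 hy.2 hs⟩⟩
  zero_mem' := ⟨tendsto_const_nhds, ⟨0, by rintro _ ⟨n, p, -, rfl⟩; simp⟩⟩
  smul_mem' c x hx := ⟨by simpa only [smul_zero] using! hx.1.const_smul c,
    ⟨_, fun _ hs => squareVariations_smul_le hx.2 c hs⟩⟩

/-- The James space `J`. It is a type of its own since its norm topology is not the topology of
pointwise convergence that `ℕ → ℝ` carries. -/
def JamesSpace : Type := jamesSubmodule

namespace JamesSpace

instance : AddCommGroup JamesSpace := inferInstanceAs (AddCommGroup jamesSubmodule)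

instance : Module ℝ JamesSpace := inferInstanceAs (Module ℝ jamesSubmodule)

/-- The sequence underlying an element of `J`. -/
def toSeq (x : JamesSpace) : ℕ → ℝ := Subtype.val x

theorem tendsto_toSeq (x : JamesSpace) : Tendsto x.toSeq atTop (𝓝 0) := (Subtype.property x).1

theorem bddAbove (x : JamesSpace) : BddAbove (squareVariations x.toSeq) := (Subtype.property x).2

theorem toSeq_add (x y : JamesSpace) : (x + y).toSeq = x.toSeq + y.toSeq := rfl

theorem toSeq_sub (x y : JamesSpace) : (x - y).toSeq = x.toSeq - y.toSeq := rfl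

theorem toSeq_smul (c : ℝ) (x : JamesSpace) : (c • x).toSeq = c • x.toSeq := rfl

theorem toSeq_injective : Function.Injective toSeq := Subtype.val_injective

noncomputable instance : Norm JamesSpace := ⟨fun x => squareVariationNorm x.toSeq⟩

theorem norm_def (x : JamesSpace) : ‖x‖ = squareVariationNorm x.toSeq := rfl

theorem abs_sub_le_norm (x : JamesSpace) {i j : ℕ} (hij : i < j) :
    |x.toSeq j - x.toSeq i| ≤ ‖x‖ := by
  refine abs_le_of_sq_le_sq' ?_ (Real.sqrt_nonneg _) |> abs_le.2
  refine le_squareVariationNorm_sq x.bddAbove ⟨1, ![i, j], ?_, by simp⟩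
  intro a b hab
  fin_cases a <;> fin_cases b <;> simp_all

theorem abs_le_norm (x : JamesSpace) (i : ℕ) : |x.toSeq i| ≤ ‖x‖ := by
  have h : Tendsto (fun j => |x.toSeq j - x.toSeq i|) atTop (𝓝 |0 - x.toSeq i|) :=
    (x.tendsto_toSeq.sub tendsto_const_nhds).abs
  have h2 := le_of_tendsto h ((eventually_gt_atTop i).mono fun j hj => x.abs_sub_le_norm hj)
  simpa using h2

theorem normedSpaceCore : NormedSpace.Core ℝ JamesSpace where
  norm_nonneg _ := Real.sqrt_nonneg _
  norm_triangle x y := squareVariationNorm_le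
    (add_nonneg (Real.sqrt_nonneg _) (Real.sqrt_nonneg _))
    fun _ hs => squareVariations_add_le x.bddAbove y.bddAbove hs
  norm_smul c x := by
    have key : ∀ (c : ℝ) (x : JamesSpace), ‖c • x‖ ≤ |c| * ‖x‖ := fun c x =>
      squareVariationNorm_le (mul_nonneg (abs_nonneg c) (Real.sqrt_nonneg _))
        fun _ hs => squareVariations_smul_le x.bddAbove c hs
    refine le_antisymm (key c x) ?_
    rcases eq_or_ne c 0 with rfl | hc
    · rw [norm_zero, zero_mul]
      exact Real.sqrt_nonneg _
    · have h := key c⁻¹ (c • x)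
      rw [smul_smul, inv_mul_cancel₀ hc, one_smul, abs_inv] at h
      rw [Real.norm_eq_abs]
      calc |c| * ‖x‖ ≤ |c| * (|c|⁻¹ * ‖c • x‖) := mul_le_mul_of_nonneg_left h (abs_nonneg c)
        _ = ‖c • x‖ := by rw [← mul_assoc, mul_inv_cancel₀ (abs_ne_zero.2 hc), one_mul]
  norm_eq_zero_iff x := by
    constructor
    · intro h
      refine toSeq_injective (funext fun i => ?_)
      have := x.abs_le_norm i
      rw [h] at this
      exact abs_nonpos_iff.1 this
    · rintro rfl
      refine le_antisymm (squareVariationNorm_le le_rfl ?_) (Real.sqrt_nonneg _)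
      rintro _ ⟨n, p, -, rfl⟩
      refine le_of_eq ?_
      have : ∀ i, (0 : JamesSpace).toSeq i = 0 := fun _ => rfl
      simp [this]

noncomputable instance : NormedAddCommGroup JamesSpace := NormedAddCommGroup.ofCore normedSpaceCore

noncomputable instance : NormedSpace ℝ JamesSpace := NormedSpace.ofCore normedSpaceCore

instance : CompleteSpace JamesSpace := by
  refine Metric.complete_of_cauchySeq_tendsto fun u hu => ?_
  have hcoord : ∀ i, ∃ a, Tendsto (fun n => (u n).toSeq i) atTop (𝓝 a) := by
    intro i
    refine cauchySeq_tendsto_of_complete (Metric.cauchySeq_iff'.2 fun ε hε => ?_)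
    obtain ⟨N, hN⟩ := Metric.cauchySeq_iff'.1 hu ε hε
    refine ⟨N, fun n hn => lt_of_le_of_lt ?_ (hN n hn)⟩
    rw [dist_eq_norm (u n), Real.dist_eq]
    exact (u n - u N).abs_le_norm i
  choose a ha using hcoord
  have hdiff : ∀ ε : ℝ, 0 < ε → ∃ N, ∀ n ≥ N,
      (∀ i, |(u n).toSeq i - a i| ≤ ε) ∧
        ∀ s ∈ squareVariations ((u n).toSeq - a), s ≤ ε ^ 2 := by
    intro ε hε
    obtain ⟨N, hN⟩ := Metric.cauchySeq_iff.1 hu ε hε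
    refine ⟨N, fun n hn => ⟨fun i => ?_, ?_⟩⟩
    · refine le_of_tendsto (tendsto_const_nhds.sub (ha i)).abs
        ((eventually_ge_atTop N).mono fun m hm => ?_)
      have h1 := (u n - u m).abs_le_norm i
      have h2 := hN n hn m hm
      rw [dist_eq_norm] at h2
      exact h1.trans h2.le
    · rintro _ ⟨k, p, hp, rfl⟩
      have ht : Tendsto (fun m => ∑ i : Fin k, |((u n).toSeq - (u m).toSeq) (p i.succ) -
          ((u n).toSeq - (u m).toSeq) (p i.castSucc)| ^ 2) atTop
          (𝓝 (∑ i : Fin k, |((u n).toSeq - a) (p i.succ) -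
          ((u n).toSeq - a) (p i.castSucc)| ^ 2)) := by
        refine tendsto_finsetSum _ fun i _ => Tendsto.pow (Tendsto.abs (Tendsto.sub ?_ ?_)) 2
        · exact tendsto_const_nhds.sub (ha _)
        · exact tendsto_const_nhds.sub (ha _)
      refine le_of_tendsto ht ((eventually_ge_atTop N).mono fun m hm => ?_)
      have h2 := hN n hn m hm
      rw [dist_eq_norm] at h2
      exact (le_squareVariationNorm_sq (u n - u m).bddAbove ⟨k, p, hp, rfl⟩).trans
        (pow_le_pow_left₀ (norm_nonneg (u n - u m)) h2.le 2)
  have ha0 : Tendsto a atTop (𝓝 0) := by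
    refine Metric.tendsto_atTop.2 fun ε hε => ?_
    obtain ⟨N, hN⟩ := hdiff (ε / 2) (half_pos hε)
    obtain ⟨M, hM⟩ := Metric.tendsto_atTop.1 (u N).tendsto_toSeq (ε / 2) (half_pos hε)
    refine ⟨M, fun i hi => ?_⟩
    have h1 := (hN N le_rfl).1 i
    have h2 := hM i hi
    rw [Real.dist_eq, sub_zero] at h2 ⊢
    rw [abs_le] at h1
    rw [abs_lt] at h2 ⊢
    constructor <;> linarith
  have hab : BddAbove (squareVariations a) := by
    obtain ⟨N, hN⟩ := hdiff 1 one_pos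
    have h1 : BddAbove (squareVariations ((-1 : ℝ) • ((u N).toSeq - a))) :=
      ⟨_, fun s hs => squareVariations_smul_le ⟨_, (hN N le_rfl).2⟩ (-1) hs⟩
    have h2 : (u N).toSeq + (-1 : ℝ) • ((u N).toSeq - a) = a := by
      ext i
      simp
    rw [← h2]
    exact ⟨_, fun s hs => squareVariations_add_le (u N).bddAbove h1 hs⟩
  let A : JamesSpace := (⟨a, ha0, hab⟩ : jamesSubmodule)
  refine ⟨A, Metric.tendsto_atTop.2 fun ε hε => ?_⟩
  obtain ⟨N, hN⟩ := hdiff (ε / 2) (half_pos hε)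
  refine ⟨N, fun n hn => lt_of_le_of_lt ?_ (half_lt_self hε)⟩
  rw [dist_eq_norm]
  exact squareVariationNorm_le (half_pos hε).le (hN n hn).2

end JamesSpace

/-! ### Bounded left approximate identities from the W.A.P. -/

section WeakApproximation

variable {𝕜 : Type*} [RCLike 𝕜] {E : Type*} [NormedAddCommGroup E] [NormedSpace 𝕜 E]

theorem ContinuousLinearMap.opNorm_le_of_closedBall_one {T : E →L[𝕜] E} {C : ℝ} (hC : 0 ≤ C)
    (h : ∀ x, ‖x‖ ≤ 1 → ‖T x‖ ≤ C) : ‖T‖ ≤ C := by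
  refine T.opNorm_le_bound hC fun x => ?_
  rcases eq_or_ne x 0 with rfl | hx
  · simp
  have hx' : ‖x‖ ≠ 0 := norm_ne_zero_iff.2 hx
  have h1 := h (((‖x‖⁻¹ : ℝ) : 𝕜) • x) (by simp [norm_smul, hx'])
  rw [map_smul, norm_smul, RCLike.norm_ofReal, abs_inv, abs_norm] at h1
  rwa [inv_mul_le_iff₀ (norm_pos_iff.2 hx), mul_comm] at h1

/-- Finitely many weakly compact operators map the closed unit ball into one weakly compact set. -/
theorem exists_isWeaklyCompactSet_of_finset (s : Finset (WeaklyCompactOperators 𝕜 E)) :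
    ∃ D : Set E, IsWeaklyCompactSet 𝕜 D ∧
      ∀ T ∈ s, ∀ x : E, ‖x‖ ≤ 1 → (T : E →L[𝕜] E) x ∈ D := by
  choose K hK h using fun T : WeaklyCompactOperators 𝕜 E =>
    isWeaklyCompactOperator_iff.1 (show IsWeaklyCompactOperator (T : E →L[𝕜] E) from T.2)
  refine ⟨toWeakSpace 𝕜 E ⁻¹' ⋃ T ∈ s, K T, ?_, fun T hT x hx => ?_⟩
  · rw [IsWeaklyCompactSet, image_preimage_eq _ (toWeakSpace 𝕜 E).surjective]
    exact s.isCompact_biUnion fun T _ => hK T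
  · exact mem_biUnion (x := T) hT (h T x hx)

theorem HasWAP.hasBLAI (h : HasWAP 𝕜 E) : HasBLAI (WeaklyCompactOperators 𝕜 E) := by
  obtain ⟨C, hC⟩ := h
  have key : ∀ α : Finset (WeaklyCompactOperators 𝕜 E) × ℕ, ∃ V : WeaklyCompactOperators 𝕜 E,
      ‖V‖ ≤ C ∧ ∀ T ∈ α.1, ‖T - V * T‖ ≤ 1 / ((α.2 : ℝ) + 1) := by
    rintro ⟨s, n⟩
    obtain ⟨D, hD, hs⟩ := exists_isWeaklyCompactSet_of_finset s
    obtain ⟨V, hV, hVD, hVC⟩ := hC D hD (1 / ((n : ℝ) + 1)) Nat.one_div_pos_of_nat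
    refine ⟨⟨V, hV⟩, hVC, fun T hT => ?_⟩
    refine ContinuousLinearMap.opNorm_le_of_closedBall_one (T := (T : E →L[𝕜] E) - V * (T : E →L[𝕜] E))
      Nat.one_div_pos_of_nat.le fun x hx => ?_
    have h1 := (le_iSup₂ (f := fun x (_ : x ∈ D) => ENNReal.ofReal ‖x - V x‖) _
      (hs T hT x hx)).trans_lt hVD
    exact (ENNReal.ofReal_lt_ofReal_iff Nat.one_div_pos_of_nat).1 h1 |>.le
  choose V hVC hV using key
  classical
  refine ⟨Finset (WeaklyCompactOperators 𝕜 E) × ℕ, inferInstance, inferInstance, inferInstance, V,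
    ⟨C, hVC⟩, fun T => ?_⟩
  refine Metric.tendsto_nhds.2 fun ε hε => ?_
  obtain ⟨n, hn⟩ := exists_nat_one_div_lt hε
  filter_upwards [eventually_ge_atTop (({T} : Finset (WeaklyCompactOperators 𝕜 E)), n)] with α hα
  rw [Real.dist_0_eq_abs]
  refine (abs_of_nonneg (norm_nonneg (T - V α * T))).trans_lt ((hV α T (hα.1 (Finset.mem_singleton_self T))).trans_lt (lt_of_le_of_lt ?_ hn))
  exact Nat.one_div_le_one_div hα.2

theorem tendsto_toWeakSpace_iff {α : Type*} {l : Filter α} {u : α → E} {x : E} :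
    Tendsto (fun a => toWeakSpace 𝕜 E (u a)) l (𝓝 (toWeakSpace 𝕜 E x)) ↔
      ∀ f : StrongDual 𝕜 E, Tendsto (fun a => f (u a)) l (𝓝 (f x)) := by
  constructor
  · intro h f
    exact ((WeakBilin.eval_continuous (topDualPairing 𝕜 E).flip f).tendsto _).comp h
  · intro h
    refine (WeakBilin.tendsto_iff_forall_eval_tendsto (topDualPairing 𝕜 E).flip fun a b hab => ?_).2 h
    exact (SeparatingDual.eq_iff_forall_dual_eq (R := 𝕜)).2 fun f => LinearMap.congr_fun hab f

theorem IsWeaklyCompactSet.exists_norm_le {D : Set E} (hD : IsWeaklyCompactSet 𝕜 D) :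
    ∃ M : ℝ, ∀ x ∈ D, ‖x‖ ≤ M := by
  obtain ⟨M, hM⟩ := banach_steinhaus
    (g := fun x : D => NormedSpace.inclusionInDoubleDual 𝕜 E x) fun f => by
      have hc : Continuous fun z : WeakSpace 𝕜 E => f ((toWeakSpace 𝕜 E).symm z) :=
        WeakBilin.eval_continuous (topDualPairing 𝕜 E).flip f
      obtain ⟨C, hC⟩ := (hD.image hc).isBounded.exists_norm_le
      exact ⟨C, fun x => hC _ ⟨_, ⟨x, x.2, rfl⟩, rfl⟩⟩
  refine ⟨M, fun x hx => ?_⟩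
  have h := hM ⟨x, hx⟩
  rwa [show ‖NormedSpace.inclusionInDoubleDual 𝕜 E x‖ = ‖x‖ from
    (NormedSpace.inclusionInDoubleDualLi 𝕜).norm_map x] at h

end WeakApproximation

/-! ### Square variations along increasing sequences -/

section SquareVariation

variable {x y : ℕ → ℝ}

theorem sum_mem_squareVariations (x : ℕ → ℝ) {p : ℕ → ℕ} (hp : StrictMono p) (n : ℕ) :
    ∑ i ∈ Finset.range n, (x (p (i + 1)) - x (p i)) ^ 2 ∈ squareVariations x :=
  ⟨n, fun i => p i, fun _ _ h => hp h, by simp [Finset.sum_range]⟩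

theorem exists_strictMono_of_mem_squareVariations {s : ℝ} (hs : s ∈ squareVariations x) :
    ∃ (p : ℕ → ℕ) (n : ℕ), StrictMono p ∧
      s = ∑ i ∈ Finset.range n, (x (p (i + 1)) - x (p i)) ^ 2 := by
  obtain ⟨n, p, hp, rfl⟩ := hs
  refine ⟨fun i => if h : i < n + 1 then p ⟨i, h⟩ else p (Fin.last n) + i, n,
    strictMono_nat_of_lt_succ fun i => ?_, ?_⟩
  · by_cases h : i + 1 < n + 1
    · have h' : i < n + 1 := by omega
      simp only [h, h', dif_pos]
      exact hp (by simp)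
    · by_cases h' : i < n + 1
      · obtain rfl : i = n := by omega
        simp [Fin.last]
      · simp only [h, h', dif_neg, not_false_eq_true]
        omega
  · rw [Finset.sum_range]
    refine Finset.sum_congr rfl fun i _ => ?_
    have h1 : (i : ℕ) + 1 < n + 1 := by omega
    have h2 : (i : ℕ) < n + 1 := by omega
    simp only [h1, h2, dif_pos, sq_abs]
    rfl

theorem forall_mem_squareVariations {P : ℝ → Prop} :
    (∀ s ∈ squareVariations x, P s) ↔ ∀ p : ℕ → ℕ, StrictMono p → ∀ n,
      P (∑ i ∈ Finset.range n, (x (p (i + 1)) - x (p i)) ^ 2) := by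
  constructor
  · exact fun h p hp n => h _ (sum_mem_squareVariations x hp n)
  · intro h s hs
    obtain ⟨p, n, hp, rfl⟩ := exists_strictMono_of_mem_squareVariations hs
    exact h p hp n

/-- The part of a bounded square variation beyond a large index is small. -/
theorem exists_forall_sum_le_of_bddAbove (hx : BddAbove (squareVariations x)) {δ : ℝ}
    (hδ : 0 < δ) : ∃ N, ∀ q : ℕ → ℕ, StrictMono q → N ≤ q 0 → ∀ n,
      ∑ i ∈ Finset.range n, (x (q (i + 1)) - x (q i)) ^ 2 ≤ δ := by
  obtain ⟨s, hs, hlt⟩ := exists_lt_of_lt_csSup ⟨0, squareVariations_zero_mem x⟩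
    (sub_lt_self (sSup (squareVariations x)) hδ)
  obtain ⟨p, k, hp, rfl⟩ := exists_strictMono_of_mem_squareVariations hs
  refine ⟨p k + 1, fun q hq hN n => ?_⟩
  let r : ℕ → ℕ := fun i => if i ≤ k then p i else q (i - (k + 1))
  have hr : StrictMono r := strictMono_nat_of_lt_succ fun i => by
    by_cases h : i + 1 ≤ k
    · have h' : i ≤ k := by omega
      simp only [r, h, h', if_true]
      exact hp (Nat.lt_succ_self i)
    · by_cases h' : i ≤ k
      · obtain rfl : i = k := by omega
        simp only [r, h, le_refl, if_true, if_false, Nat.sub_self]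
        omega
      · simp only [r, h, h', if_false]
        exact hq (by omega)
  have hle := le_csSup hx (sum_mem_squareVariations x hr (k + 1 + n))
  rw [Finset.sum_range_add, Finset.sum_range_succ] at hle
  have h1 : ∑ i ∈ Finset.range k, (x (r (i + 1)) - x (r i)) ^ 2 =
      ∑ i ∈ Finset.range k, (x (p (i + 1)) - x (p i)) ^ 2 := by
    refine Finset.sum_congr rfl fun i hi => ?_
    rw [Finset.mem_range] at hi
    simp only [r, show i + 1 ≤ k by omega, show i ≤ k by omega, if_true]
  have h2 : ∑ i ∈ Finset.range n, (x (r (k + 1 + i + 1)) - x (r (k + 1 + i))) ^ 2 =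
      ∑ i ∈ Finset.range n, (x (q (i + 1)) - x (q i)) ^ 2 := by
    refine Finset.sum_congr rfl fun i _ => ?_
    simp only [r, show ¬ k + 1 + i + 1 ≤ k by omega, show ¬ k + 1 + i ≤ k by omega, if_false]
    congr 4 <;> omega
  have h3 := sq_nonneg (x (r (k + 1)) - x (r k))
  rw [h1, h2] at hle
  linarith

theorem exists_tendsto_of_bddAbove_squareVariations (hx : BddAbove (squareVariations x)) :
    ∃ c, Tendsto x atTop (𝓝 c) := by
  refine cauchySeq_tendsto_of_complete (Metric.cauchySeq_iff'.2 fun ε hε => ?_)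
  obtain ⟨N, hN⟩ := exists_forall_sum_le_of_bddAbove hx (δ := (ε / 2) ^ 2) (by positivity)
  refine ⟨N, fun n hn => ?_⟩
  rcases hn.eq_or_lt with rfl | hlt
  · simpa using hε
  have h := hN (fun i => if i = 0 then N else n + i - 1) (strictMono_nat_of_lt_succ fun i => by
    by_cases h : i = 0 <;> simp [h] <;> omega) (by simp) 1
  simp only [Finset.sum_range_one] at h
  rw [Real.dist_eq]
  have h' := abs_le_of_sq_le_sq (by simpa using h) (half_pos hε).le
  exact h'.trans_lt (half_lt_self hε)

/-- Splitting a variation sum at the place where the indices pass `N`. -/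
theorem sum_variation_split (p : ℕ → ℕ) (N n : ℕ) :
    p n < N ∨ N ≤ p 0 ∨ ∃ j k, n = j + 1 + k ∧ p j < N ∧ N ≤ p (j + 1) ∧ ∀ y : ℕ → ℝ,
      ∑ i ∈ Finset.range n, (y (p (i + 1)) - y (p i)) ^ 2 =
        ∑ i ∈ Finset.range j, (y (p (i + 1)) - y (p i)) ^ 2 + (y (p (j + 1)) - y (p j)) ^ 2 +
        ∑ i ∈ Finset.range k, (y (p (j + 1 + (i + 1))) - y (p (j + 1 + i))) ^ 2 := by
  by_cases hn : p n < N
  · exact Or.inl hn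
  by_cases h0 : N ≤ p 0
  · exact Or.inr (Or.inl h0)
  refine Or.inr (Or.inr ?_)
  have hex : ∃ i, N ≤ p i := ⟨n, not_lt.1 hn⟩
  classical
  obtain ⟨j, hj⟩ : ∃ j, Nat.find hex = j + 1 := Nat.exists_eq_succ_of_ne_zero fun h =>
    h0 (h ▸ Nat.find_spec hex)
  have hjn : j + 1 ≤ n := hj ▸ Nat.find_min' hex (not_lt.1 hn)
  obtain ⟨k, rfl⟩ := Nat.exists_eq_add_of_le hjn
  refine ⟨j, k, rfl, not_le.1 (Nat.find_min hex (by omega)), hj ▸ Nat.find_spec hex, fun y => ?_⟩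
  rw [Finset.sum_range_add, Finset.sum_range_succ]
  rfl

theorem sum_variation_le_of_sum_sq_le {B : ℝ} (hy : ∀ n, ∑ i ∈ Finset.range n, y i ^ 2 ≤ B)
    {p : ℕ → ℕ} (hp : StrictMono p) (n : ℕ) :
    ∑ i ∈ Finset.range n, (y (p (i + 1)) - y (p i)) ^ 2 ≤ 4 * B := by
  have hsub : ∀ q : ℕ → ℕ, StrictMono q → ∑ i ∈ Finset.range n, y (q i) ^ 2 ≤ B := by
    intro q hq
    refine le_trans ?_ (hy (q n))
    rw [← Finset.sum_image (f := fun i => y i ^ 2) (g := q) hq.injective.injOn]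
    refine Finset.sum_le_sum_of_subset_of_nonneg ?_ fun _ _ _ => sq_nonneg _
    intro i hi
    obtain ⟨j, hj, rfl⟩ := Finset.mem_image.1 hi
    exact Finset.mem_range.2 (hq (Finset.mem_range.1 hj))
  calc ∑ i ∈ Finset.range n, (y (p (i + 1)) - y (p i)) ^ 2
      ≤ ∑ i ∈ Finset.range n, (2 * y (p (i + 1)) ^ 2 + 2 * y (p i) ^ 2) :=
        Finset.sum_le_sum fun i _ => by nlinarith [sq_nonneg (y (p (i + 1)) + y (p i))]
    _ = 2 * ∑ i ∈ Finset.range n, y (p (i + 1)) ^ 2 + 2 * ∑ i ∈ Finset.range n, y (p i) ^ 2 := by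
        rw [Finset.sum_add_distrib, Finset.mul_sum, Finset.mul_sum]
    _ ≤ 4 * B := by
        have h1 := hsub (fun i => p (i + 1)) fun a b h => hp (by omega)
        have h2 := hsub p hp
        linarith

end SquareVariation

namespace JamesSpace

/-- The element of `J` given by a null sequence of bounded square variation. -/
def ofSeq (x : ℕ → ℝ) (h0 : Tendsto x atTop (𝓝 0)) (hb : BddAbove (squareVariations x)) :
    JamesSpace := (⟨x, h0, hb⟩ : jamesSubmodule)

theorem sum_le_norm_sq (x : JamesSpace) {p : ℕ → ℕ} (hp : StrictMono p) (n : ℕ) :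
    ∑ i ∈ Finset.range n, (x.toSeq (p (i + 1)) - x.toSeq (p i)) ^ 2 ≤ ‖x‖ ^ 2 :=
  le_squareVariationNorm_sq x.bddAbove (sum_mem_squareVariations _ hp n)

theorem norm_le_of_forall_sum_le {x : JamesSpace} {C : ℝ} (hC : 0 ≤ C)
    (h : ∀ p : ℕ → ℕ, StrictMono p → ∀ n,
      ∑ i ∈ Finset.range n, (x.toSeq (p (i + 1)) - x.toSeq (p i)) ^ 2 ≤ C ^ 2) : ‖x‖ ≤ C :=
  squareVariationNorm_le hC (forall_mem_squareVariations.2 h)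

theorem norm_le_of_forall_sum_sq_le {x : JamesSpace} {C : ℝ} (hC : 0 ≤ C)
    (h : ∀ n, ∑ i ∈ Finset.range n, x.toSeq i ^ 2 ≤ C ^ 2) : ‖x‖ ≤ 2 * C := by
  refine norm_le_of_forall_sum_le (by positivity) fun p hp n => ?_
  have := sum_variation_le_of_sum_sq_le h hp n
  linarith

/-- The coordinate functionals. -/
noncomputable def coord (i : ℕ) : StrongDual ℝ JamesSpace :=
  LinearMap.mkContinuous
    { toFun := fun x => x.toSeq i
      map_add' := fun _ _ => rfl
      map_smul' := fun _ _ => rfl } 1 fun x => (x.abs_le_norm i).trans_eq (one_mul _).symm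

theorem coord_apply (i : ℕ) (x : JamesSpace) : coord i x = x.toSeq i := rfl

/-- Passing to the subsequence with indices `g`. -/
noncomputable def subseq (g : ℕ → ℕ) (hg : StrictMono g) : JamesSpace →L[ℝ] JamesSpace :=
  LinearMap.mkContinuous
    { toFun := fun x => ofSeq (x.toSeq ∘ g) (x.tendsto_toSeq.comp hg.tendsto_atTop)
        ⟨‖x‖ ^ 2, forall_mem_squareVariations.2 fun _ hp n => x.sum_le_norm_sq (hg.comp hp) n⟩
      map_add' := fun _ _ => rfl
      map_smul' := fun _ _ => rfl } 1 fun x => by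
    rw [one_mul]
    exact norm_le_of_forall_sum_le (norm_nonneg x) fun _ hp n => x.sum_le_norm_sq (hg.comp hp) n

theorem norm_subseq_le (g : ℕ → ℕ) (hg : StrictMono g) : ‖subseq g hg‖ ≤ 1 :=
  LinearMap.mkContinuous_norm_le _ zero_le_one _

/-! ### Truncations -/

theorem sum_truncate_sq_le (x : ℕ → ℝ) (N n : ℕ) :
    ∑ i ∈ Finset.range n, (if i < N then x i else 0) ^ 2 ≤ ∑ i ∈ Finset.range N, x i ^ 2 := by
  calc ∑ i ∈ Finset.range n, (if i < N then x i else 0) ^ 2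
      = ∑ i ∈ (Finset.range n).filter (· < N), x i ^ 2 := by
        rw [Finset.sum_filter]
        exact Finset.sum_congr rfl fun i _ => by split_ifs <;> simp
    _ ≤ ∑ i ∈ Finset.range N, x i ^ 2 :=
        Finset.sum_le_sum_of_subset_of_nonneg (fun i hi => by simp at hi ⊢; exact hi.2)
          fun _ _ _ => sq_nonneg _

/-- The truncation of `x` to the indices below `N`. -/
def head (N : ℕ) (x : JamesSpace) : JamesSpace :=
  ofSeq (fun i => if i < N then x.toSeq i else 0)
    (tendsto_const_nhds.congr' <| (eventually_ge_atTop N).mono fun i hi => by simp [hi.not_gt])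
    ⟨_, forall_mem_squareVariations.2 fun _ hp n =>
      sum_variation_le_of_sum_sq_le (sum_truncate_sq_le x.toSeq N) hp n⟩

theorem head_toSeq (N : ℕ) (x : JamesSpace) (i : ℕ) :
    (head N x).toSeq i = if i < N then x.toSeq i else 0 := rfl

theorem norm_head_le (N : ℕ) (x : JamesSpace) :
    ‖head N x‖ ≤ 2 * Real.sqrt (∑ i ∈ Finset.range N, x.toSeq i ^ 2) := by
  refine norm_le_of_forall_sum_sq_le (Real.sqrt_nonneg _) fun n => ?_
  rw [Real.sq_sqrt (Finset.sum_nonneg fun _ _ => sq_nonneg _)]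
  exact sum_truncate_sq_le x.toSeq N n

theorem tendsto_norm_head {α : Type*} {l : Filter α} {u : α → JamesSpace}
    (h : ∀ i, Tendsto (fun a => (u a).toSeq i) l (𝓝 0)) (N : ℕ) :
    Tendsto (fun a => ‖head N (u a)‖) l (𝓝 0) := by
  refine squeeze_zero (fun _ => norm_nonneg _) (fun a => norm_head_le N (u a)) ?_
  have h1 : Tendsto (fun a => ∑ i ∈ Finset.range N, (u a).toSeq i ^ 2) l (𝓝 0) := by
    simpa using tendsto_finsetSum (Finset.range N) fun i _ => (h i).pow 2
  simpa using (h1.sqrt).const_mul 2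

theorem exists_norm_sub_head_le (x : JamesSpace) {ε : ℝ} (hε : 0 < ε) (K : ℕ) :
    ∃ N ≥ K, ‖x - head N x‖ ≤ ε := by
  obtain ⟨N₁, hN₁⟩ := exists_forall_sum_le_of_bddAbove x.bddAbove (δ := ε ^ 2 / 2) (by positivity)
  have h0 : Tendsto (fun i => x.toSeq i ^ 2) atTop (𝓝 0) := by simpa using x.tendsto_toSeq.pow 2
  obtain ⟨N₂, hN₂⟩ := eventually_atTop.1 (h0.eventually_le_const (show 0 < ε ^ 2 / 2 by positivity))
  let N := max K (max N₁ N₂)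
  have hNN₁ : N₁ ≤ N := (le_max_left _ _).trans (le_max_right _ _)
  have hNN₂ : N₂ ≤ N := (le_max_right _ _).trans (le_max_right _ _)
  have hlow : ∀ i < N, (x - head N x).toSeq i = 0 := fun i hi => by
    rw [toSeq_sub, Pi.sub_apply, head_toSeq, if_pos hi, sub_self]
  have hhigh : ∀ i ≥ N, (x - head N x).toSeq i = x.toSeq i := fun i hi => by
    rw [toSeq_sub, Pi.sub_apply, head_toSeq, if_neg (not_lt.2 hi), sub_zero]
  refine ⟨N, le_max_left _ _, norm_le_of_forall_sum_le hε.le fun p hp n => ?_⟩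
  rcases sum_variation_split p N n with h | h | ⟨j, k, rfl, hj, hj', hsum⟩
  · refine (Finset.sum_eq_zero fun i hi => ?_).trans_le (sq_nonneg ε)
    have hi' := Finset.mem_range.1 hi
    rw [hlow _ ((hp.monotone (by omega : i + 1 ≤ n)).trans_lt h),
      hlow _ ((hp.monotone hi'.le).trans_lt h)]
    simp
  · have h1 := hN₁ p hp (hNN₁.trans h) n
    refine (Finset.sum_congr rfl fun i _ => ?_).trans_le (h1.trans (by linarith [sq_nonneg ε]))
    rw [hhigh _ (h.trans (hp.monotone (Nat.zero_le _))),
      hhigh _ (h.trans (hp.monotone (Nat.zero_le _)))]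
  · rw [hsum]
    have e1 : ∑ i ∈ Finset.range j,
        ((x - head N x).toSeq (p (i + 1)) - (x - head N x).toSeq (p i)) ^ 2 = 0 := by
      refine Finset.sum_eq_zero fun i hi => ?_
      have hi' := Finset.mem_range.1 hi
      rw [hlow _ ((hp.monotone (by omega : i + 1 ≤ j)).trans_lt hj),
        hlow _ ((hp.monotone hi'.le).trans_lt hj)]
      simp
    have e2 := hN₁ (fun i => p (j + 1 + i)) (fun a b h => hp (by omega)) (hNN₁.trans hj') k
    have e3 : ∑ i ∈ Finset.range k, ((x - head N x).toSeq (p (j + 1 + (i + 1))) -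
        (x - head N x).toSeq (p (j + 1 + i))) ^ 2 =
        ∑ i ∈ Finset.range k, (x.toSeq (p (j + 1 + (i + 1))) - x.toSeq (p (j + 1 + i))) ^ 2 :=
      Finset.sum_congr rfl fun i _ => by
        rw [hhigh _ (hj'.trans (hp.monotone (by omega))),
          hhigh _ (hj'.trans (hp.monotone (by omega)))]
    rw [e1, e3, hlow _ hj, hhigh _ hj', sub_zero, zero_add]
    have e4 := hN₂ _ (hNN₂.trans hj')
    linarith

/-! ### Bounded pointwise null families are weakly null -/

/-- Square variations with an extra weight at the last index are at most `B`. -/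
def WeightedVariationLE (x : ℕ → ℝ) (B : ℝ) : Prop :=
  ∀ p : ℕ → ℕ, StrictMono p → ∀ n,
    ∑ i ∈ Finset.range n, (x (p (i + 1)) - x (p i)) ^ 2 + 2 * x (p n) ^ 2 ≤ B

theorem WeightedVariationLE.nonneg {x : ℕ → ℝ} {B : ℝ} (h : WeightedVariationLE x B) : 0 ≤ B := by
  refine le_trans ?_ (h id strictMono_id 0)
  simp only [Finset.range_zero, Finset.sum_empty, zero_add]
  positivity

/-- Adding a vector supported beyond the support of `x` increases the weighted variation by at most
a constant. -/
theorem WeightedVariationLE.add {x : ℕ → ℝ} {u : JamesSpace} {B M : ℝ} {N : ℕ}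
    (h : WeightedVariationLE x B) (hx : ∀ i ≥ N, x i = 0) (hu : ∀ i < N, u.toSeq i = 0)
    (hM : ‖u‖ ≤ M) : WeightedVariationLE (x + u.toSeq) (B + 5 * M ^ 2) := by
  intro p hp n
  have hM2 : ‖u‖ ^ 2 ≤ M ^ 2 := pow_le_pow_left₀ (norm_nonneg u) hM 2
  have hlow : ∀ i < N, (x + u.toSeq) i = x i := fun i hi => by rw [Pi.add_apply, hu i hi, add_zero]
  have hhigh : ∀ i ≥ N, (x + u.toSeq) i = u.toSeq i := fun i hi => by
    rw [Pi.add_apply, hx i hi, zero_add]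
  have hsq : ∀ i, u.toSeq i ^ 2 ≤ M ^ 2 := fun i => by
    rw [← sq_abs]
    exact (pow_le_pow_left₀ (abs_nonneg _) (u.abs_le_norm i) 2).trans hM2
  rcases sum_variation_split p N n with hn | h0 | ⟨j, k, rfl, hj, hj', hsum⟩
  · refine le_trans (le_of_eq ?_) ((h p hp n).trans (by linarith [sq_nonneg M]))
    rw [hlow _ hn]
    refine congrArg₂ _ (Finset.sum_congr rfl fun i hi => ?_) rfl
    have hi' := Finset.mem_range.1 hi
    rw [hlow _ ((hp.monotone (by omega : i + 1 ≤ n)).trans_lt hn),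
      hlow _ ((hp.monotone hi'.le).trans_lt hn)]
  · have hge : ∀ i, N ≤ p i := fun i => h0.trans (hp.monotone (Nat.zero_le _))
    have h1 := u.sum_le_norm_sq hp n
    simp only [hhigh _ (hge _)]
    linarith [hsq (p n), h.nonneg, sq_nonneg M]
  · have hge : ∀ i, N ≤ p (j + 1 + i) := fun i => hj'.trans (hp.monotone (by omega))
    have e1 : ∑ i ∈ Finset.range j, ((x + u.toSeq) (p (i + 1)) - (x + u.toSeq) (p i)) ^ 2 =
        ∑ i ∈ Finset.range j, (x (p (i + 1)) - x (p i)) ^ 2 := by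
      refine Finset.sum_congr rfl fun i hi => ?_
      have hi' := Finset.mem_range.1 hi
      rw [hlow _ ((hp.monotone (by omega : i + 1 ≤ j)).trans_lt hj),
        hlow _ ((hp.monotone hi'.le).trans_lt hj)]
    have e2 := u.sum_le_norm_sq (p := fun i => p (j + 1 + i)) (fun a b h => hp (by omega)) k
    have e3 := h p hp j
    rw [hsum, e1, hlow _ hj]
    simp only [hhigh _ (hge _), hhigh _ hj']
    have e4 := hsq (p (j + 1))
    have e5 := hsq (p (j + 1 + k))
    have e6 : (u.toSeq (p (j + 1)) - x (p j)) ^ 2 ≤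
        2 * u.toSeq (p (j + 1)) ^ 2 + 2 * x (p j) ^ 2 := by
      nlinarith [sq_nonneg (u.toSeq (p (j + 1)) + x (p j))]
    linarith

theorem WeightedVariationLE.norm_sq_le {x : JamesSpace} {B : ℝ}
    (h : WeightedVariationLE x.toSeq B) : ‖x‖ ^ 2 ≤ B := by
  have h1 : ‖x‖ ≤ Real.sqrt B := norm_le_of_forall_sum_le (Real.sqrt_nonneg B) fun p hp n => by
    rw [Real.sq_sqrt h.nonneg]
    linarith [h p hp n, sq_nonneg (x.toSeq (p n))]
  exact (Real.le_sqrt (norm_nonneg x) h.nonneg).1 h1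

/-- The coordinate functionals of `J` determine the weak topology on bounded sets. -/
theorem tendsto_dual_zero_of_bounded {α : Type*} {l : Filter α} {u : α → JamesSpace} {M : ℝ}
    (hM : ∀ᶠ a in l, ‖u a‖ ≤ M) (h : ∀ i, Tendsto (fun a => (u a).toSeq i) l (𝓝 0))
    (f : StrongDual ℝ JamesSpace) : Tendsto (fun a => f (u a)) l (𝓝 0) := by
  by_contra hnot
  obtain ⟨ε, hε, hfreq⟩ : ∃ ε > 0, ∃ᶠ a in l, ε ≤ |f (u a)| := by
    rw [Metric.tendsto_nhds] at hnot
    push Not at hnot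
    obtain ⟨ε, hε, hf⟩ := hnot
    exact ⟨ε, hε, by simpa using hf⟩
  let η : ℝ := min (1 / 2) (ε / (4 * (‖f‖ + 1)))
  have hη : 0 < η := lt_min (by norm_num) (by positivity)
  have hη1 : η ≤ 1 / 2 := min_le_left _ _
  have hfη : ‖f‖ * (2 * η) ≤ ε / 2 := by
    have h1 : η * (4 * (‖f‖ + 1)) ≤ ε := (le_div_iff₀ (by positivity)).1 (min_le_right _ _)
    nlinarith [norm_nonneg f]
  have hblock : ∀ N, ∃ (N' : ℕ) (v : JamesSpace), (∀ i < N, v.toSeq i = 0) ∧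
      (∀ i ≥ N', v.toSeq i = 0) ∧ N ≤ N' ∧ ‖v‖ ≤ M + 1 ∧ ε / 2 ≤ f v := by
    intro N
    obtain ⟨a, ha, haM, hhead⟩ := (hfreq.and_eventually
      (hM.and ((tendsto_norm_head h N).eventually_le_const hη))).exists
    obtain ⟨N', hN', htail⟩ := exists_norm_sub_head_le (u a) hη N
    let v := head N' (u a) - head N (u a)
    have hv : ‖u a - v‖ ≤ 2 * η := by
      have e : u a - v = (u a - head N' (u a)) + head N (u a) := by simp only [v]; abel
      rw [e]
      exact (norm_add_le _ _).trans (by linarith)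
    have hvM : ‖v‖ ≤ M + 1 := by
      have e : v = u a - (u a - v) := by abel
      rw [e]
      exact (norm_sub_le _ _).trans (by linarith)
    have hlow : ∀ i < N, v.toSeq i = 0 := fun i hi => by
      rw [toSeq_sub, Pi.sub_apply, head_toSeq, head_toSeq, if_pos hi, if_pos (hi.trans_le hN'),
        sub_self]
    have hhigh : ∀ i ≥ N', v.toSeq i = 0 := fun i hi => by
      rw [toSeq_sub, Pi.sub_apply, head_toSeq, head_toSeq, if_neg (not_lt.2 hi),
        if_neg (not_lt.2 (hN'.trans hi)), sub_self]
    have hfv : ε / 2 ≤ |f v| := by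
      have h1 : |f (u a) - f v| ≤ ε / 2 := by
        rw [← map_sub]
        exact (f.le_opNorm _).trans ((mul_le_mul_of_nonneg_left hv (norm_nonneg f)).trans hfη)
      have h2 := abs_sub_abs_le_abs_sub (f (u a)) (f v)
      linarith
    rcases le_total 0 (f v) with h0 | h0
    · exact ⟨N', v, hlow, hhigh, hN', hvM, by rwa [abs_of_nonneg h0] at hfv⟩
    · refine ⟨N', (-1 : ℝ) • v, fun i hi => ?_, fun i hi => ?_, hN', by simpa using hvM, ?_⟩
      · rw [toSeq_smul, Pi.smul_apply, hlow i hi, smul_zero]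
      · rw [toSeq_smul, Pi.smul_apply, hhigh i hi, smul_zero]
      · rw [map_smul, smul_eq_mul, neg_one_mul]
        rwa [abs_of_nonpos h0] at hfv
  have hsum : ∀ n : ℕ, ∃ (N : ℕ) (S : JamesSpace), (∀ i ≥ N, S.toSeq i = 0) ∧
      WeightedVariationLE S.toSeq (n * (5 * (M + 1) ^ 2)) ∧ n * (ε / 2) ≤ f S := by
    intro n
    induction n with
    | zero =>
      refine ⟨0, 0, fun _ _ => rfl, fun p _ n => ?_, by simp⟩
      have : ∀ i, (0 : JamesSpace).toSeq i = 0 := fun _ => rfl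
      simp [this]
    | succ n ih =>
      obtain ⟨N, S, hS, hSB, hfS⟩ := ih
      obtain ⟨N', v, hlow, hhigh, hN, hvM, hfv⟩ := hblock N
      refine ⟨N', S + v, fun i hi => ?_, ?_, ?_⟩
      · rw [toSeq_add, Pi.add_apply, hS i (hN.trans hi), hhigh i hi, add_zero]
      · rw [toSeq_add, Nat.cast_succ, add_one_mul]
        exact hSB.add hS hlow hvM
      · rw [map_add, Nat.cast_succ, add_one_mul]
        exact add_le_add hfS hfv
  obtain ⟨n, hn⟩ := exists_nat_gt (‖f‖ ^ 2 * (5 * (M + 1) ^ 2) / (ε / 2) ^ 2)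
  rw [div_lt_iff₀ (by positivity)] at hn
  obtain ⟨N, S, -, hSB, hfS⟩ := hsum n
  have h1 := hSB.norm_sq_le
  have h2 : (n * (ε / 2)) ^ 2 ≤ ‖f‖ ^ 2 * ‖S‖ ^ 2 := by
    rw [← mul_pow]
    exact pow_le_pow_left₀ (by positivity) (hfS.trans ((le_abs_self _).trans (f.le_opNorm S))) 2
  have h3 := h2.trans (mul_le_mul_of_nonneg_left h1 (sq_nonneg ‖f‖))
  have hn0 : 0 < (n : ℝ) := by
    refine pos_of_mul_pos_left (lt_of_le_of_lt ?_ hn) (by positivity)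
    positivity
  nlinarith [mul_lt_mul_of_pos_left hn hn0]

/-! ### The W.A.P. of the James space -/

/-- Bounded ultrafilters on `J` converge coordinatewise to an element of `J` plus a constant. -/
theorem exists_tendsto_toSeq_add_const (U : Ultrafilter JamesSpace) {M : ℝ}
    (hU : ∀ᶠ x in (U : Filter JamesSpace), ‖x‖ ≤ M) :
    ∃ (w : JamesSpace) (c : ℝ), ‖w‖ ≤ M ∧
      ∀ i, Tendsto (fun x : JamesSpace => x.toSeq i) U (𝓝 (w.toSeq i + c)) := by
  have hM : 0 ≤ M := by
    obtain ⟨x, hx⟩ := hU.exists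
    exact (norm_nonneg x).trans hx
  have hlim : ∀ i, ∃ z : ℝ, Tendsto (fun x : JamesSpace => x.toSeq i) U (𝓝 z) := fun i => by
    obtain ⟨z, -, hz⟩ := isCompact_iff_ultrafilter_le_nhds'.1 (isCompact_Icc (a := -M) (b := M))
      (U.map fun x : JamesSpace => x.toSeq i)
      (hU.mono fun x hx => abs_le.1 ((x.abs_le_norm i).trans hx))
    exact ⟨z, hz⟩
  choose z hz using hlim
  have hvar : ∀ p : ℕ → ℕ, StrictMono p → ∀ n,
      ∑ i ∈ Finset.range n, (z (p (i + 1)) - z (p i)) ^ 2 ≤ M ^ 2 := fun p hp n => by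
    have ht : Tendsto (fun x : JamesSpace => ∑ i ∈ Finset.range n,
        (x.toSeq (p (i + 1)) - x.toSeq (p i)) ^ 2) U
        (𝓝 (∑ i ∈ Finset.range n, (z (p (i + 1)) - z (p i)) ^ 2)) :=
      tendsto_finsetSum _ fun i _ => ((hz _).sub (hz _)).pow 2
    exact le_of_tendsto ht (hU.mono fun x hx =>
      (x.sum_le_norm_sq hp n).trans (pow_le_pow_left₀ (norm_nonneg x) hx 2))
  obtain ⟨c, hc⟩ := exists_tendsto_of_bddAbove_squareVariations
    ⟨M ^ 2, forall_mem_squareVariations.2 hvar⟩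
  have hvar' : ∀ p : ℕ → ℕ, StrictMono p → ∀ n,
      ∑ i ∈ Finset.range n, ((z (p (i + 1)) - c) - (z (p i) - c)) ^ 2 ≤ M ^ 2 := fun p hp n => by
    simpa only [sub_sub_sub_cancel_right] using hvar p hp n
  refine ⟨ofSeq (fun i => z i - c) (by simpa using hc.sub_const c)
    ⟨M ^ 2, forall_mem_squareVariations.2 hvar'⟩, c, norm_le_of_forall_sum_le hM hvar', fun i => ?_⟩
  exact (hz i).trans_eq (congrArg 𝓝 (sub_add_cancel (z i) c).symm)

theorem isWeaklyCompactOperator_id_sub_subseq (g : ℕ → ℕ) (hg : StrictMono g) :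
    IsWeaklyCompactOperator (ContinuousLinearMap.id ℝ JamesSpace - subseq g hg) := by
  let T := ContinuousLinearMap.id ℝ JamesSpace - subseq g hg
  have hT : ∀ x i, (T x).toSeq i = x.toSeq i - x.toSeq (g i) := fun _ _ => rfl
  refine isWeaklyCompactOperator_iff.2
    ⟨(fun x => toWeakSpace ℝ JamesSpace (T x)) '' {x | ‖x‖ ≤ 1}, ?_, fun x hx => ⟨x, hx, rfl⟩⟩
  refine isCompact_iff_ultrafilter_le_nhds'.2 fun V hV => ?_
  let U := Ultrafilter.ofComapInfPrincipal hV
  have hUV : U.map (fun x => toWeakSpace ℝ JamesSpace (T x)) = V :=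
    Ultrafilter.ofComapInfPrincipal_eq_of_map hV
  have hU : ∀ᶠ x in (U : Filter JamesSpace), ‖x‖ ≤ 1 := Ultrafilter.ofComapInfPrincipal_mem hV
  obtain ⟨w, c, hw, hlim⟩ := exists_tendsto_toSeq_add_const U hU
  refine ⟨_, ⟨w, hw, rfl⟩, ?_⟩
  rw [← hUV]
  refine tendsto_toWeakSpace_iff.2 fun f => ?_
  have h0 := tendsto_dual_zero_of_bounded (l := (U : Filter JamesSpace)) (u := fun x => T (x - w))
    (M := ‖T‖ * (1 + 1)) (hU.mono fun x hx => (T.le_opNorm _).trans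
      (mul_le_mul_of_nonneg_left ((norm_sub_le x w).trans (add_le_add hx hw)) (norm_nonneg T)))
    (fun i => by
      have h1 : Tendsto (fun x : JamesSpace => (x.toSeq i - x.toSeq (g i)) -
          (w.toSeq i - w.toSeq (g i))) U (𝓝 (((w.toSeq i + c) - (w.toSeq (g i) + c)) -
          (w.toSeq i - w.toSeq (g i)))) := ((hlim i).sub (hlim (g i))).sub_const _
      rw [add_sub_add_right_eq_sub, sub_self] at h1
      simpa only [map_sub, toSeq_sub, Pi.sub_apply, hT] using h1) f
  simpa using h0.add_const (f (T w))

/-- A weakly compact subset of `J` has small entries, at bounded distance after any index. -/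
theorem exists_forall_exists_abs_lt {D : Set JamesSpace} (hD : IsWeaklyCompactSet ℝ D) (N : ℕ)
    {δ : ℝ} (hδ : 0 < δ) : ∃ q > N, ∀ x ∈ D, ∃ t, N < t ∧ t < q ∧ |x.toSeq t| < δ := by
  obtain ⟨s, hs⟩ := hD.elim_finite_subcover
    (fun t : {t // N < t} => {z : WeakSpace ℝ JamesSpace |
      |coord t ((toWeakSpace ℝ JamesSpace).symm z)| < δ})
    (fun t => isOpen_lt (WeakBilin.eval_continuous (topDualPairing ℝ JamesSpace).flip
      (coord (t : ℕ))).abs continuous_const)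
    (by
      rintro _ ⟨x, -, rfl⟩
      obtain ⟨t, ht, hNt⟩ := ((x.tendsto_toSeq.abs.eventually_lt_const
        (by simpa using hδ)).and (eventually_gt_atTop N)).exists
      exact mem_iUnion.2 ⟨⟨t, hNt⟩, ht⟩)
  refine ⟨max N (s.sup Subtype.val) + 1, by omega, fun x hx => ?_⟩
  obtain ⟨t, ht, hxt⟩ := mem_iUnion₂.1 (hs ⟨x, hx, rfl⟩)
  have hle : (t : ℕ) ≤ s.sup Subtype.val := Finset.le_sup (f := Subtype.val) ht
  exact ⟨t, t.2, by omega, hxt⟩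

theorem sum_half_pow_sq_le (n : ℕ) : ∑ i ∈ Finset.range n, ((1 / 2 : ℝ) ^ i) ^ 2 ≤ 2 := by
  have h : ∀ i : ℕ, ((1 / 2 : ℝ) ^ i) ^ 2 ≤ (1 / 2 : ℝ) ^ i := fun i => by
    have h0 : 0 ≤ (1 / 2 : ℝ) ^ i := by positivity
    have h1 : (1 / 2 : ℝ) ^ i ≤ 1 := pow_le_one₀ (by norm_num) (by norm_num)
    nlinarith
  exact (Finset.sum_le_sum fun i _ => h i).trans (sum_geometric_two_le n)

/-- On a weakly compact subset of `J` some subsequence of coordinates is uniformly square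
summable. -/
theorem exists_strictMono_sum_sq_le {D : Set JamesSpace} (hD : IsWeaklyCompactSet ℝ D) :
    ∃ (m : ℕ → ℕ) (B : ℝ), StrictMono m ∧ 0 ≤ B ∧
      ∀ x ∈ D, ∀ n, ∑ i ∈ Finset.range n, x.toSeq (m i) ^ 2 ≤ B := by
  obtain ⟨M, hM⟩ := hD.exists_norm_le
  choose q hq hqD using fun (N i : ℕ) =>
    exists_forall_exists_abs_lt hD N (show 0 < (1 / 2 : ℝ) ^ i by positivity)
  let m : ℕ → ℕ := fun n => Nat.rec 0 (fun i N => q N i) n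
  have hm : StrictMono m := strictMono_nat_of_lt_succ fun i => hq (m i) i
  refine ⟨m, 2 * M ^ 2 + 4, hm, by positivity, fun x hx n => ?_⟩
  choose t hmt htm hxt using fun i => hqD (m i) i x hx
  have htm' : ∀ i, t i < m (i + 1) := htm
  let p : ℕ → ℕ := fun k => if k % 2 = 0 then m (k / 2) else t (k / 2)
  have hp : StrictMono p := strictMono_nat_of_lt_succ fun k => by
    rcases Nat.mod_two_eq_zero_or_one k with h | h
    · have h1 : (k + 1) % 2 = 1 := by omega
      have h2 : (k + 1) / 2 = k / 2 := by omega
      simp only [p, h, h1, h2, if_true, one_ne_zero, if_false]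
      exact hmt _
    · have h1 : (k + 1) % 2 = 0 := by omega
      have h2 : (k + 1) / 2 = k / 2 + 1 := by omega
      simp only [p, h, h1, h2, if_true, one_ne_zero, if_false]
      exact htm' _
  have heven : ∀ i, p (2 * i) = m i := fun i => by simp [p]
  have hodd : ∀ i, p (2 * i + 1) = t i := fun i => by
    simp [p, show (2 * i + 1) % 2 = 1 by omega, show (2 * i + 1) / 2 = i by omega]
  have hvar : ∑ i ∈ Finset.range n, (x.toSeq (t i) - x.toSeq (m i)) ^ 2 ≤ M ^ 2 := by
    have h1 := (x.sum_le_norm_sq hp (2 * n)).trans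
      (pow_le_pow_left₀ (norm_nonneg x) (hM x hx) 2)
    refine le_trans ?_ h1
    calc ∑ i ∈ Finset.range n, (x.toSeq (t i) - x.toSeq (m i)) ^ 2
        = ∑ i ∈ Finset.range n, (x.toSeq (p (2 * i + 1)) - x.toSeq (p (2 * i))) ^ 2 := by
          simp only [heven, hodd]
      _ = ∑ k ∈ (Finset.range n).image (2 * ·), (x.toSeq (p (k + 1)) - x.toSeq (p k)) ^ 2 := by
          rw [Finset.sum_image fun a _ b _ h => by simpa using h]
      _ ≤ _ := by
          refine Finset.sum_le_sum_of_subset_of_nonneg ?_ fun _ _ _ => sq_nonneg _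
          intro k hk
          obtain ⟨i, hi, rfl⟩ := Finset.mem_image.1 hk
          rw [Finset.mem_range] at hi ⊢
          omega
  calc ∑ i ∈ Finset.range n, x.toSeq (m i) ^ 2
      ≤ ∑ i ∈ Finset.range n, (2 * (x.toSeq (t i) - x.toSeq (m i)) ^ 2 +
          2 * ((1 / 2 : ℝ) ^ i) ^ 2) := Finset.sum_le_sum fun i _ => by
        have h1 : x.toSeq (t i) ^ 2 ≤ ((1 / 2 : ℝ) ^ i) ^ 2 := by
          rw [← sq_abs]
          exact pow_le_pow_left₀ (abs_nonneg _) (hxt i).le 2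
        nlinarith [sq_nonneg (x.toSeq (t i) + (x.toSeq (t i) - x.toSeq (m i)))]
    _ = 2 * ∑ i ∈ Finset.range n, (x.toSeq (t i) - x.toSeq (m i)) ^ 2 +
          2 * ∑ i ∈ Finset.range n, ((1 / 2 : ℝ) ^ i) ^ 2 := by
        rw [Finset.sum_add_distrib, Finset.mul_sum, Finset.mul_sum]
    _ ≤ 2 * M ^ 2 + 4 := by linarith [sum_half_pow_sq_le n]

theorem strictMono_arithmetic {m : ℕ → ℕ} (hm : StrictMono m) (n r : ℕ) :
    StrictMono fun j => m ((n + 1) * j + r) :=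
  fun _ _ h => hm (Nat.add_lt_add_right (Nat.mul_lt_mul_of_pos_left h n.succ_pos) r)

/-- The average of the subsequence operators along the `n + 1` residue classes of positions in
`m`. -/
noncomputable def average {m : ℕ → ℕ} (hm : StrictMono m) (n : ℕ) :
    JamesSpace →L[ℝ] JamesSpace :=
  ((n : ℝ) + 1)⁻¹ • ∑ r ∈ Finset.range (n + 1), subseq _ (strictMono_arithmetic hm n r)

theorem norm_average_le {m : ℕ → ℕ} (hm : StrictMono m) (n : ℕ) : ‖average hm n‖ ≤ 1 := by
  have h1 : ‖∑ r ∈ Finset.range (n + 1), subseq _ (strictMono_arithmetic hm n r)‖ ≤ (n : ℝ) + 1 := by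
    refine (norm_sum_le_of_le _ fun r _ => norm_subseq_le _ _).trans ?_
    simp
  have h2 : (0 : ℝ) < n + 1 := by positivity
  rw [average, norm_smul, norm_inv, Real.norm_of_nonneg h2.le]
  exact (inv_mul_le_iff₀ h2).2 (by simpa using h1)

theorem isWeaklyCompactOperator_id_sub_average {m : ℕ → ℕ} (hm : StrictMono m) (n : ℕ) :
    IsWeaklyCompactOperator (ContinuousLinearMap.id ℝ JamesSpace - average hm n) := by
  have h : ContinuousLinearMap.id ℝ JamesSpace - average hm n =
      ((n : ℝ) + 1)⁻¹ • ∑ r ∈ Finset.range (n + 1),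
        (ContinuousLinearMap.id ℝ JamesSpace - subseq _ (strictMono_arithmetic hm n r)) := by
    have hn : (n : ℝ) + 1 ≠ 0 := by positivity
    rw [Finset.sum_sub_distrib, smul_sub, average, Finset.sum_const, Finset.card_range,
      ← Nat.cast_smul_eq_nsmul ℝ, smul_smul, Nat.cast_succ, inv_mul_cancel₀ hn, one_smul]
  rw [h]
  exact IsWeaklyCompactOperator.smul (sum_mem (S := WeaklyCompactOperators ℝ JamesSpace) fun r _ =>
    isWeaklyCompactOperator_id_sub_subseq _ (strictMono_arithmetic hm n r)) _

theorem average_toSeq {m : ℕ → ℕ} (hm : StrictMono m) (n : ℕ) (x : JamesSpace) (j : ℕ) :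
    (average hm n x).toSeq j =
      ((n : ℝ) + 1)⁻¹ * ∑ r ∈ Finset.range (n + 1), x.toSeq (m ((n + 1) * j + r)) := by
  rw [← coord_apply, average, smul_apply, sum_apply,
    map_smul, map_sum, smul_eq_mul]
  rfl

theorem sum_range_mul (f : ℕ → ℝ) (n K : ℕ) :
    ∑ j ∈ Finset.range K, ∑ r ∈ Finset.range n, f (n * j + r) =
      ∑ i ∈ Finset.range (n * K), f i := by
  induction K with
  | zero => simp
  | succ K ih => rw [Finset.sum_range_succ, ih, Nat.mul_succ, Finset.sum_range_add]

theorem norm_average_apply_le {m : ℕ → ℕ} (hm : StrictMono m) (n : ℕ) {x : JamesSpace} {B : ℝ}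
    (hB : 0 ≤ B) (h : ∀ n, ∑ i ∈ Finset.range n, x.toSeq (m i) ^ 2 ≤ B) :
    ‖average hm n x‖ ≤ 2 * Real.sqrt (B / (n + 1)) := by
  have hn : (0 : ℝ) < n + 1 := by positivity
  refine norm_le_of_forall_sum_sq_le (Real.sqrt_nonneg _) fun K => ?_
  rw [Real.sq_sqrt (by positivity)]
  have hj : ∀ j, (average hm n x).toSeq j ^ 2 ≤
      ((n : ℝ) + 1)⁻¹ * ∑ r ∈ Finset.range (n + 1), x.toSeq (m ((n + 1) * j + r)) ^ 2 := fun j => by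
    have h1 := sq_sum_le_card_mul_sum_sq (s := Finset.range (n + 1))
      (f := fun r => x.toSeq (m ((n + 1) * j + r)))
    rw [Finset.card_range, Nat.cast_succ] at h1
    rw [average_toSeq, mul_pow]
    calc _ ≤ ((n : ℝ) + 1)⁻¹ ^ 2 * _ := mul_le_mul_of_nonneg_left h1 (by positivity)
      _ = _ := by field_simp
  calc ∑ j ∈ Finset.range K, (average hm n x).toSeq j ^ 2
      ≤ ∑ j ∈ Finset.range K, ((n : ℝ) + 1)⁻¹ *
          ∑ r ∈ Finset.range (n + 1), x.toSeq (m ((n + 1) * j + r)) ^ 2 :=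
        Finset.sum_le_sum fun j _ => hj j
    _ = ((n : ℝ) + 1)⁻¹ * ∑ i ∈ Finset.range ((n + 1) * K), x.toSeq (m i) ^ 2 := by
        rw [← Finset.mul_sum, sum_range_mul (fun i => x.toSeq (m i) ^ 2)]
    _ ≤ B / (n + 1) := by
        rw [div_eq_inv_mul]
        exact mul_le_mul_of_nonneg_left (h _) (by positivity)

theorem hasWAP : HasWAP ℝ JamesSpace := by
  refine ⟨2, fun D hD ε hε => ?_⟩
  obtain ⟨m, B, hm, hB, hD⟩ := exists_strictMono_sum_sq_le hD
  have hlim : Tendsto (fun n : ℕ => 2 * Real.sqrt (B / ((n : ℝ) + 1))) atTop (𝓝 0) := by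
    have h1 := (tendsto_one_div_add_atTop_nhds_zero_nat (𝕜 := ℝ)).const_mul B
    simpa [div_eq_mul_inv] using h1.sqrt.const_mul 2
  obtain ⟨n, hn⟩ := (hlim.eventually_le_const (half_pos hε)).exists
  refine ⟨ContinuousLinearMap.id ℝ JamesSpace - average hm n,
    isWeaklyCompactOperator_id_sub_average hm n, ?_, ?_⟩
  · refine lt_of_le_of_lt (iSup₂_le fun x hx => ENNReal.ofReal_le_ofReal ?_)
      ((ENNReal.ofReal_lt_ofReal_iff hε).2 (half_lt_self hε))
    rw [sub_apply, ContinuousLinearMap.id_apply, sub_sub_cancel]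
    exact (norm_average_apply_le hm n hB (hD x hx)).trans hn
  · refine (norm_sub_le _ _).trans ?_
    linarith [ContinuousLinearMap.norm_id_le (𝕜 := ℝ) (E := JamesSpace), norm_average_le hm n]

end JamesSpace

theorem proposition2p5 :
    (∀ (𝕜 : Type*) [RCLike 𝕜] (E : Type*) [NormedAddCommGroup E] [NormedSpace 𝕜 E]
        [CompleteSpace E], HasWAP 𝕜 E → HasBLAI (WeaklyCompactOperators 𝕜 E)) ∧
      HasBLAI (WeaklyCompactOperators ℝ JamesSpace) := by
  exact ⟨fun _ _ _ _ _ _ h => h.hasBLAI, JamesSpace.hasWAP.hasBLAI⟩
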